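/- Equip the category $\mathbf{SmCat}$ of small categories with the Joyal–Tierney model structure: the cofibrations are the functors that are injective on objects, the weak equivalences are the equivalences of categories, and the fibrations are the functors with the right lifting property with respect to the cofibrations that are also weak equivalences. Write $1$ for the terminal category and $S^0=1\amalg 1$. A *$0$-dimensional CW-complex* is a cofibrant object that is a coproduct of a set of copies of $1$. A *$1$-dimensional CW-complex* is an object $W$ for which there are a set $I$, a $0$-dimensional CW-complex $Z$, a functor $f:\coprod_{i\in I}S^0\to Z$, and a factorization $$\coprod_{i\in I}S^0\xrightarrow{\ j\ }\widetilde Y\xrightarrow{\ q\ }\coprod_{i\in I}1$$ of the coproduct of the unique maps $S^0\to 1$ into a cofibration $j$ followed by an acyclic fibration $q$, such that $W$ is the pushout of $Z\xleftarrow{\,f\,}\coprod_{i\in I}S^0\xrightarrow{\,j\,}\widetilde Y$. Let $\mathbf C_2$ be the category with two objects and exactly one morphism from each object to each object (two objects linked by a single isomorphism), and let $S^0\to\mathbf C_2$ be the inclusion of its two objects. **Theorem.** Let $X$ be a small category. 1. $X$ is a $1$-dimensional CW-complex if and only if $X$ is a groupoid in which the automorphism group of every object is a free group. 2. $X$ is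 a $1$-dimensional CW-complex if and only if it arises by attaching free isomorphisms to a discrete category, that is, if and only if there are a set $I$, a discrete category $A$ and a functor $f:\coprod_{I}S^0\to A$ such that $X$ is the pushout of $A\xleftarrow{\,f\,}\coprod_I S^0\to\coprod_I\mathbf C_2$. 3. $X$ is weakly equivalent (through a zigzag of equivalences of categories) to a $1$-dimensional CW-complex if and only if $X$ is a groupoid in which the automorphism group of every object is a free group. -/

import Mathlib

open CategoryTheory Limits HomotopicalAlgebra

universe v u

namespace FormalCW

section General

/-- `W` is a homotopy pushout of `Z ⟵ X ⟶ Y` (along `f` and `g`): `X` is replaced by a cofibrant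
object, the two maps are replaced by cofibrations, all three replacements being made along
acyclic fibrations, and `W` is the pushout of the replaced diagram. -/
def IsHomotopyPushout {C : Type u} [Category.{v} C] [CategoryWithFibrations C]
    [CategoryWithCofibrations C] [CategoryWithWeakEquivalences C] [HasInitial C]
    {X Y Z : C} (f : X ⟶ Z) (g : X ⟶ Y) (W : C) : Prop :=
  ∃ (X' Y' Z' : C) (x : X' ⟶ X) (y : Y' ⟶ Y) (z : Z' ⟶ Z) (f' : X' ⟶ Z') (g' : X' ⟶ Y')
    (k : Z' ⟶ W) (l : Y' ⟶ W),
    IsPushout f' g' k l ∧ IsCofibrant X' ∧ Cofibration f' ∧ Cofibration g' ∧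
      trivialFibrations C x ∧ trivialFibrations C y ∧ trivialFibrations C z ∧
      f' ≫ z = x ≫ f ∧ g' ≫ y = x ≫ g

/-- `W` is a one-sided homotopy pushout of `f : X ⟶ Z` along `g : X ⟶ Y`, where `X` is cofibrant:
`g` is factored as a cofibration `g' : X ⟶ Y'` followed by an acyclic fibration `y : Y' ⟶ Y`,
and `W` is the pushout of `f` along `g'`. -/
def IsOneSidedHomotopyPushout {C : Type u} [Category.{v} C] [CategoryWithFibrations C]
    [CategoryWithCofibrations C] [CategoryWithWeakEquivalences C] [HasInitial C]
    {X Y Z : C} (f : X ⟶ Z) (g : X ⟶ Y) (W : C) : Prop :=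
  IsCofibrant X ∧
    ∃ (Y' : C) (g' : X ⟶ Y') (y : Y' ⟶ Y) (k : Z ⟶ W) (l : Y' ⟶ W),
      IsPushout f g' k l ∧ Cofibration g' ∧ trivialFibrations C y ∧ g' ≫ y = g

/-- `IsSphere n S`: the object `S` is an `n`-sphere. A `0`-sphere is a coproduct `1 ⨿ 1` of two
copies of the terminal object, and an `(n + 1)`-sphere is a homotopy pushout of `1 ⟵ S' ⟶ 1`
for an `n`-sphere `S'`. -/
def IsSphere {C : Type u} [Category.{v} C] [CategoryWithFibrations C]
    [CategoryWithCofibrations C] [CategoryWithWeakEquivalences C] [HasInitial C]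
    [HasTerminal C] : ℕ → C → Prop
  | 0, S => ∃ a b : ⊤_ C ⟶ S, Nonempty (IsColimit (BinaryCofan.mk a b))
  | n + 1, S => ∃ S' : C, IsSphere n S' ∧
      IsHomotopyPushout (terminal.from S') (terminal.from S') S

/-- `IsCWComplex n X`: the object `X` is an `n`-dimensional CW-complex. For `n = 0` this means
that `X` is cofibrant and a coproduct of copies of the terminal object. An
`(n + 1)`-dimensional CW-complex is a one-sided homotopy pushout of a map `∐ᵢ Sᵢ ⟶ Y`, where `Y`
is an `n`-dimensional CW-complex and the `Sᵢ` are `n`-spheres indexed by a set, along the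
coproduct `∐ᵢ Sᵢ ⟶ ∐ᵢ 1` of the maps `Sᵢ ⟶ 1`. -/
def IsCWComplex {C : Type u} [Category.{v} C] [CategoryWithFibrations C]
    [CategoryWithCofibrations C] [CategoryWithWeakEquivalences C] [HasInitial C]
    [HasTerminal C] : ℕ → C → Prop
  | 0, X => IsCofibrant X ∧
      ∃ (I : Type v) (ι : I → (⊤_ C ⟶ X)), Nonempty (IsColimit (Cofan.mk X ι))
  | n + 1, X => ∃ (Y : C) (I : Type v) (S : I → C) (s : Cofan S) (t : Cofan fun _ : I ↦ ⊤_ C)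
      (f : s.pt ⟶ Y) (g : s.pt ⟶ t.pt),
      IsCWComplex n Y ∧ (∀ i, IsSphere n (S i)) ∧
        Nonempty (IsColimit s) ∧ Nonempty (IsColimit t) ∧
        (∀ i, s.inj i ≫ g = terminal.from (S i) ≫ t.inj i) ∧
        IsOneSidedHomotopyPushout f g X

/-- Two objects are weakly equivalent if a zigzag of weak equivalences joins them. -/
def WeaklyEquivalent {C : Type u} [Category.{v} C] [CategoryWithWeakEquivalences C]
    (X Y : C) : Prop :=
  Relation.EqvGen (fun A B : C ↦ ∃ f : A ⟶ B, WeakEquivalence f) X Y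

end General

section JoyalTierney

/-- Cofibrations: the functors that are injective on objects. -/
instance catCofibrations : CategoryWithCofibrations Cat.{u, u} where
  cofibrations _ _ F := Function.Injective F.toFunctor.obj

/-- Weak equivalences: the equivalences of categories. -/
instance catWeakEquivalences : CategoryWithWeakEquivalences Cat.{u, u} where
  weakEquivalences _ _ F := F.toFunctor.IsEquivalence

/-- Fibrations: the functors with the right lifting property with respect to the cofibrations
that are also weak equivalences. -/
instance catFibrations : CategoryWithFibrations Cat.{u, u} where
  fibrations := (trivialCofibrations Cat.{u, u}).rlp

end JoyalTierney

/-- The objects of the free isomorphism `C₂`. -/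
inductive FreeIso : Type u
  | left
  | right

/-- The free isomorphism `C₂`: two objects, and exactly one morphism from each object to each
object, so that the two objects are joined by a single isomorphism. -/
instance : SmallCategory FreeIso.{u} where
  Hom _ _ := PUnit.{u + 1}
  id _ := ⟨⟩
  comp _ _ := ⟨⟩

/-- The functor `1 ⟶ C₂` that picks an object of `C₂`. -/
noncomputable def FreeIso.point (a : FreeIso.{u}) : ⊤_ Cat.{u, u} ⟶ Cat.of FreeIso.{u} :=
  ((Functor.const (⊤_ Cat.{u, u})).obj a).toCatHom

/-- The inclusion `S⁰ = 1 ⨿ 1 ⟶ C₂` of the two objects. -/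
noncomputable def FreeIso.endpoints :
    (⊤_ Cat.{u, u}) ⨿ (⊤_ Cat.{u, u}) ⟶ Cat.of FreeIso.{u} :=
  coprod.desc (FreeIso.point .left) (FreeIso.point .right)

/-- `X` arises from a discrete category by attaching free isomorphisms: it is the pushout of a
functor `∐_I S⁰ ⟶ A` to a discrete category along the inclusion `∐_I S⁰ ⟶ ∐_I C₂`. -/
def ArisesByAttachingFreeIsos (X : Cat.{u, u}) : Prop :=
  ∃ (A I : Type u)
    (f : (∐ fun _ : I ↦ (⊤_ Cat.{u, u}) ⨿ (⊤_ Cat.{u, u})) ⟶ Cat.of (Discrete A))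
    (k : Cat.of (Discrete A) ⟶ X) (l : (∐ fun _ : I ↦ Cat.of FreeIso.{u}) ⟶ X),
    IsPushout f (Limits.Sigma.map fun _ : I ↦ FreeIso.endpoints.{u}) k l

/-- `X` is a groupoid in which the automorphism group of each object is a free group. -/
def IsGroupoidWithFreeAut (X : Cat.{u, u}) : Prop :=
  IsGroupoid X ∧ ∀ x : X, IsFreeGroup (Aut x)

end FormalCW

namespace FormalCW

/-! The proof is a cycle: a 1-dimensional CW-complex is a groupoid with free automorphism groups,
such a groupoid arises by attaching free isomorphisms, and such an attachment is a 1-dimensional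
CW-complex.

For the first implication, the attached object `Y'` is equivalent to a discrete category, hence a
thin groupoid, and a pushout of groupoids is a groupoid (`isGroupoid_of_isPushout`). Free generation
is tested on functors to groups. A discrete category has only one functor to a group, so functors
from the pushout to a group are the same as functors from `Y'`
(`existsUnique_functor_of_isPushout`), and these are given by free values on a family of morphisms
(`isFreeOn_of_thin`). Each component of the pushout is thus a connected free groupoid, whose vertex
groups are free.

For the second, choose a base object in each component, an isomorphism from it to each other object,
and free generators of its automorphism group. These isomorphisms freely generate the groupoid among
all categories, which is the universal property of the pushout.

For the third, the projection `∐ C₂ ⟶ ∐ 1` is an acyclic fibration. The statement on weak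
equivalence follows because fully faithful functors reflect the groupoid condition and preserve
automorphism groups. -/

theorem isDiscrete_of_iso {C D : Cat.{v, u}} (e : C ≅ D) [IsDiscrete C] : IsDiscrete D where
  subsingleton _ _ :=
    ⟨fun _ _ ↦ (Cat.equivOfIso e).inverse.map_injective (Subsingleton.elim _ _)⟩
  eq_of_hom {x y} f := by
    have h : e.inv.toFunctor.obj x = e.inv.toFunctor.obj y :=
      IsDiscrete.eq_of_hom (e.inv.toFunctor.map f)
    have h' (z : D) : e.hom.toFunctor.obj (e.inv.toFunctor.obj z) = z :=
      congr($(e.inv_hom_id).toFunctor.obj z)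
    rw [← h' x, h, h']

instance : IsDiscrete (⊤_ Cat.{u, u}) :=
  @isDiscrete_of_iso _ _
    (Cat.isoDiscretePUnitOfIsTerminal (T := ⊤_ Cat.{u, u}) terminalIsTerminal).symm
    (inferInstanceAs (IsDiscrete (Discrete PUnit)))

/-- The object of the terminal category. -/
noncomputable def terminalObj : (⊤_ Cat.{u, u}) :=
  (Cat.isoDiscretePUnitOfIsTerminal
    (T := ⊤_ Cat.{u, u}) terminalIsTerminal).inv.toFunctor.obj ⟨⟨⟩⟩

theorem eq_terminalObj (x : (⊤_ Cat.{u, u})) : x = terminalObj := by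
  have h (z : (⊤_ Cat.{u, u})) := congr($((Cat.isoDiscretePUnitOfIsTerminal
    (T := ⊤_ Cat.{u, u}) terminalIsTerminal).hom_inv_id).toFunctor.obj z)
  exact (h x).symm

/-- Functors out of a discrete category are determined by their values on objects. -/
theorem functor_ext_of_isDiscrete {C : Type*} [Category C] [IsDiscrete C] {D : Type*} [Category D]
    {F G : C ⥤ D} (h : ∀ x, F.obj x = G.obj x) : F = G := by
  refine CategoryTheory.Functor.ext h fun x y f ↦ ?_
  obtain rfl := IsDiscrete.eq_of_hom f
  obtain rfl : f = 𝟙 x := Subsingleton.elim _ _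
  simp

theorem hom_terminal_ext {D : Cat.{u, u}} {F G : ⊤_ Cat.{u, u} ⟶ D}
    (h : F.toFunctor.obj terminalObj = G.toFunctor.obj terminalObj) : F = G :=
  Cat.Hom.ext <| functor_ext_of_isDiscrete fun x ↦ by rw [eq_terminalObj x, h]

/-- The discrete category on `I` is a coproduct of terminal categories. -/
noncomputable def discreteCofan (I : Type u) : Cofan fun _ : I ↦ ⊤_ Cat.{u, u} :=
  Cofan.mk (Cat.of (Discrete I)) fun i ↦
    ((Functor.const (⊤_ Cat.{u, u})).obj (Discrete.mk i)).toCatHom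

/-- The discrete category on `I` is a coproduct of terminal categories. -/
noncomputable def discreteCofanIsColimit (I : Type u) : IsColimit (discreteCofan I) :=
  Cofan.IsColimit.mk _
    (fun s ↦ (Discrete.functor fun i ↦ (s.inj i).toFunctor.obj terminalObj).toCatHom)
    (fun _ _ ↦ hom_terminal_ext rfl)
    (fun _ _ hm ↦ Cat.Hom.ext <| functor_ext_of_isDiscrete (C := Discrete I) fun i ↦
      congr($(hm i.as).toFunctor.obj terminalObj))

theorem isDiscrete_of_isColimit {I : Type u} {t : Cofan fun _ : I ↦ ⊤_ Cat.{u, u}}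
    (ht : IsColimit t) : IsDiscrete t.pt :=
  @isDiscrete_of_iso _ _ ((discreteCofanIsColimit I).coconePointUniqueUpToIso ht)
    (inferInstanceAs (IsDiscrete (Discrete I)))

theorem isGroupoid_of_isDiscrete (C : Type*) [Category C] [IsDiscrete C] : IsGroupoid C where

/-- The sigma category is a coproduct. -/
def sigmaCofan {I : Type u} (C : I → Cat.{u, u}) : Cofan C :=
  Cofan.mk (Cat.of (Σ i, C i)) fun i ↦ (Sigma.incl (C := fun i ↦ C i) i).toCatHom

/-- The sigma category is a coproduct. -/
def sigmaCofanIsColimit {I : Type u} (C : I → Cat.{u, u}) : IsColimit (sigmaCofan C) :=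
  Cofan.IsColimit.mk _
    (fun s ↦ (Sigma.desc fun i ↦ (s.inj i).toFunctor).toCatHom)
    (fun s i ↦ rfl)
    (fun s m hm ↦ by
      refine Cat.Hom.ext <| CategoryTheory.Functor.hext
        (fun ⟨i, x⟩ ↦ congr($(hm i).toFunctor.obj x)) ?_
      rintro ⟨i, x⟩ ⟨_, y⟩ ⟨f⟩
      exact congr_arg_heq (fun F : C i ⟶ s.pt ↦ F.toFunctor.map f) (hm i))

/-! ### Acyclic fibrations, and attached free isomorphisms as 1-cells -/

/-- A fully faithful functor that is surjective on objects has the right lifting property with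
respect to the functors that are injective on objects. -/
theorem trivialFibrations_of_surjective {E B : Cat.{u, u}} (p : E ⟶ B)
    [p.toFunctor.Full] [p.toFunctor.Faithful] (hp : Function.Surjective p.toFunctor.obj) :
    trivialFibrations Cat.{u, u} p := by
  refine ⟨fun A C i hi ↦ ⟨fun {f g} sq ↦ ?_⟩,
    { essSurj := ⟨fun b ↦ ⟨_, ⟨eqToIso (hp b).choose_spec⟩⟩⟩ }⟩
  classical
  have hinj : Function.Injective i.toFunctor.obj := hi.1
  have hw (a : A) : p.toFunctor.obj (f.toFunctor.obj a) = g.toFunctor.obj (i.toFunctor.obj a) :=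
    congr($(sq.w).toFunctor.obj a)
  have hex (c : C) : ∃ e : E, p.toFunctor.obj e = g.toFunctor.obj c ∧
      ∀ a, i.toFunctor.obj a = c → f.toFunctor.obj a = e := by
    by_cases h : ∃ a, i.toFunctor.obj a = c
    · obtain ⟨a, rfl⟩ := h
      exact ⟨f.toFunctor.obj a, hw a, fun b hb ↦ by rw [hinj hb]⟩
    · obtain ⟨e, he⟩ := hp (g.toFunctor.obj c)
      exact ⟨e, he, fun a ha ↦ (h ⟨a, ha⟩).elim⟩
  choose o ho ho' using hex
  let L : C ⥤ E :=
    { obj := o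
      map {x y} m := p.toFunctor.preimage
        (eqToHom (ho x) ≫ g.toFunctor.map m ≫ eqToHom (ho y).symm)
      map_id x := p.toFunctor.map_injective (by simp)
      map_comp m n := p.toFunctor.map_injective (by simp) }
  have hL {x y : C} (m : x ⟶ y) : p.toFunctor.map (L.map m) =
      eqToHom (ho x) ≫ g.toFunctor.map m ≫ eqToHom (ho y).symm := by simp [L]
  refine ⟨⟨⟨L.toCatHom, Cat.Hom.ext <| CategoryTheory.Functor.ext
    (fun a ↦ (ho' (i.toFunctor.obj a) a rfl).symm) fun a b m ↦ p.toFunctor.map_injective ?_,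
    Cat.Hom.ext <| CategoryTheory.Functor.ext ho fun x y m ↦ hL m⟩⟩⟩
  have := Functor.congr_hom congr($(sq.w).toFunctor) m
  simp only [Cat.Hom.comp_toFunctor, Functor.comp_map] at this
  refine (hL (i.toFunctor.map m)).trans ?_
  simp [this, eqToHom_map]

theorem cofibration_of_injective {A B : Cat.{u, u}} (F : A ⟶ B)
    (h : Function.Injective F.toFunctor.obj) : Cofibration F := ⟨h⟩

theorem isEmpty_initial : IsEmpty (⊥_ Cat.{u, u}) :=
  ⟨fun x ↦ ((initial.to (Cat.of (Discrete PEmpty.{u + 1}))).toFunctor.obj x).as.elim⟩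

theorem isCofibrant (X : Cat.{u, u}) : IsCofibrant X :=
  cofibration_of_injective _ fun x ↦ (isEmpty_initial.false x).elim

theorem isCWComplex_zero_discrete (A : Type u) : IsCWComplex 0 (Cat.of (Discrete A)) :=
  ⟨isCofibrant _, A, (discreteCofan A).inj, ⟨discreteCofanIsColimit A⟩⟩

/-- The functor to the free isomorphism given by a function on objects. -/
def toFreeIso (C : Cat.{u, u}) (o : C → FreeIso.{u}) : C ⟶ Cat.of FreeIso.{u} :=
  Functor.toCatHom { obj := o, map _ := ⟨⟩ }

theorem hom_freeIso_ext {C : Cat.{u, u}} {F G : C ⟶ Cat.of FreeIso.{u}}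
    (h : ∀ x, F.toFunctor.obj x = G.toFunctor.obj x) : F = G :=
  Cat.Hom.ext <| CategoryTheory.Functor.ext h fun _ _ _ ↦ rfl

/-- `FreeIso` is indiscrete, so functors into it are arbitrary functions on objects. An object
missed by all the injections would have an indicator functor that the injections cannot tell from a
constant one. -/
theorem exists_inj_obj_eq {I : Type u} {C : I → Cat.{u, u}} {s : Cofan C} (hs : IsColimit s)
    (x : s.pt) : ∃ (i : I) (y : C i), (s.inj i).toFunctor.obj y = x := by
  classical
  by_contra! hx
  have h : toFreeIso s.pt (fun z ↦ if z = x then .left else .right) =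
      toFreeIso s.pt fun _ ↦ .right :=
    Cofan.IsColimit.hom_ext hs _ _ fun i ↦ hom_freeIso_ext fun y ↦ if_neg (hx i y)
  have := congr($(h).toFunctor.obj x)
  simp [toFreeIso] at this

theorem sphere_obj_cases (x : ↑((⊤_ Cat.{u, u}) ⨿ (⊤_ Cat.{u, u}))) :
    x = (coprod.inl : ⊤_ Cat.{u, u} ⟶ (⊤_ Cat.{u, u}) ⨿ (⊤_ Cat.{u, u})).toFunctor.obj terminalObj ∨
    x = (coprod.inr :
      ⊤_ Cat.{u, u} ⟶ (⊤_ Cat.{u, u}) ⨿ (⊤_ Cat.{u, u})).toFunctor.obj terminalObj := by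
  classical
  by_contra! hx
  have h : toFreeIso _ (fun z ↦ if z = x then .left else .right) =
      toFreeIso ((⊤_ Cat.{u, u}) ⨿ (⊤_ Cat.{u, u}) : Cat.{u, u}) fun _ ↦ .right :=
    coprod.hom_ext (hom_terminal_ext <| if_neg hx.1.symm) (hom_terminal_ext <| if_neg hx.2.symm)
  have := congr($(h).toFunctor.obj x)
  simp [toFreeIso] at this

theorem endpoints_inl : (coprod.inl ≫ FreeIso.endpoints.{u}).toFunctor.obj terminalObj =
    FreeIso.left := by
  rw [FreeIso.endpoints, coprod.inl_desc]
  rfl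

theorem endpoints_inr : (coprod.inr ≫ FreeIso.endpoints.{u}).toFunctor.obj terminalObj =
    FreeIso.right := by
  rw [FreeIso.endpoints, coprod.inr_desc]
  rfl

theorem endpoints_injective : Function.Injective FreeIso.endpoints.{u}.toFunctor.obj := by
  have hl := endpoints_inl.{u}
  have hr := endpoints_inr.{u}
  simp only [Cat.Hom.comp_toFunctor, Functor.comp_obj] at hl hr
  intro x y h
  rcases sphere_obj_cases x with rfl | rfl <;> rcases sphere_obj_cases y with rfl | rfl
  · rfl
  · rw [hl, hr] at h
    cases h
  · rw [hl, hr] at h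
    cases h
  · rfl

theorem inj_obj_eq_iff {I : Type u} {C : I → Cat.{u, u}} {s : Cofan C} (hs : IsColimit s)
    {i j : I} {x : C i} {y : C j} :
    (s.inj i).toFunctor.obj x = (s.inj j).toFunctor.obj y ↔
      (⟨i, x⟩ : Σ i, C i) = ⟨j, y⟩ := by
  refine ⟨fun h ↦ ?_, by rintro ⟨⟩; rfl⟩
  have key (k : I) (z : C k) : (Cofan.IsColimit.desc hs
      (sigmaCofan C).inj).toFunctor.obj ((s.inj k).toFunctor.obj z) = (⟨k, z⟩ : Σ i, C i) :=
    congr($(Cofan.IsColimit.fac hs (sigmaCofan C).inj k).toFunctor.obj z)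
  rw [← key, h, key]

theorem sigmaMap_injective {I : Type u} {C D : I → Cat.{u, u}} (F : ∀ i, C i ⟶ D i)
    (hF : ∀ i, Function.Injective (F i).toFunctor.obj) :
    Function.Injective (Limits.Sigma.map F).toFunctor.obj := by
  have key (i : I) (x : C i) : (Limits.Sigma.map F).toFunctor.obj
      ((Limits.Sigma.ι C i).toFunctor.obj x) =
      (Limits.Sigma.ι D i).toFunctor.obj ((F i).toFunctor.obj x) :=
    congr($(Limits.Sigma.ι_map F i).toFunctor.obj x)
  intro x y h
  obtain ⟨i, x, rfl⟩ := exists_inj_obj_eq (coproductIsCoproduct C) x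
  obtain ⟨j, y, rfl⟩ := exists_inj_obj_eq (coproductIsCoproduct C) y
  have h' := (key i x).symm.trans (h.trans (key j y))
  obtain ⟨rfl, h'⟩ := Sigma.mk.inj ((inj_obj_eq_iff (coproductIsCoproduct D)).1 h')
  rw [hF i (eq_of_heq h')]

/-- The projection of a coproduct of free isomorphisms to the discrete category on its index
set. -/
noncomputable def freeIsoProj (I : Type u) :
    (∐ fun _ : I ↦ Cat.of FreeIso.{u}) ⟶ Cat.of (Discrete I) :=
  Limits.Sigma.desc fun i ↦ ((Functor.const FreeIso.{u}).obj (Discrete.mk i)).toCatHom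

theorem ι_freeIsoProj {I : Type u} (i : I) :
    Limits.Sigma.ι (fun _ : I ↦ Cat.of FreeIso.{u}) i ≫ freeIsoProj I =
      ((Functor.const FreeIso.{u}).obj (Discrete.mk i)).toCatHom :=
  Limits.Sigma.ι_desc _ _

theorem trivialFibrations_freeIsoProj (I : Type u) :
    trivialFibrations Cat.{u, u} (freeIsoProj I) := by
  let C (_ : I) : Cat.{u, u} := Cat.of FreeIso.{u}
  let e : (∐ C) ≅ Cat.of (Σ i, C i) :=
    (coproductIsCoproduct C).coconePointUniqueUpToIso (sigmaCofanIsColimit C)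
  let q : Cat.of (Σ i, C i) ⟶ Cat.of (Discrete I) :=
    (sigmaCofanIsColimit C).desc
      (Cofan.mk _ fun i ↦ ((Functor.const FreeIso.{u}).obj (Discrete.mk i)).toCatHom)
  -- Fullness and faithfulness can be read off on the sigma category and are carried back along `e`.
  have hq : freeIsoProj I = e.hom ≫ q := by
    refine Limits.Sigma.hom_ext _ _ fun i ↦ (Limits.Sigma.ι_desc _ _).trans ?_
    exact (eq_whisker ((coproductIsCoproduct C).comp_coconePointUniqueUpToIso_hom
      (sigmaCofanIsColimit C) ⟨i⟩) q).symm
  have : e.hom.toFunctor.IsEquivalence := (Cat.equivOfIso e).isEquivalence_functor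
  have : q.toFunctor.Full := ⟨by
    rintro ⟨i, a⟩ ⟨j, b⟩ ⟨⟨h⟩⟩
    obtain rfl : i = j := h
    exact ⟨Sigma.SigmaHom.mk ⟨⟩, rfl⟩⟩
  have : q.toFunctor.Faithful := ⟨by
    rintro ⟨i, a⟩ ⟨_, b⟩ ⟨f⟩ ⟨g⟩ _
    rfl⟩
  have : (freeIsoProj I).toFunctor.Full := by
    rw [hq]; exact Functor.Full.comp e.hom.toFunctor q.toFunctor
  have : (freeIsoProj I).toFunctor.Faithful := by
    rw [hq]; exact Functor.Faithful.comp e.hom.toFunctor q.toFunctor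
  exact trivialFibrations_of_surjective _ fun i ↦
    ⟨(Limits.Sigma.ι C i.as).toFunctor.obj .left,
      congr($(ι_freeIsoProj i.as).toFunctor.obj .left)⟩

theorem isCWComplex_one_of_arisesByAttachingFreeIsos {X : Cat.{u, u}}
    (h : ArisesByAttachingFreeIsos X) : IsCWComplex 1 X := by
  obtain ⟨A, I, f, k, l, hX⟩ := h
  refine ⟨_, I, fun _ ↦ (⊤_ Cat.{u, u}) ⨿ (⊤_ Cat.{u, u}), _, discreteCofan I, f,
    Limits.Sigma.map (fun _ : I ↦ FreeIso.endpoints.{u}) ≫ freeIsoProj I,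
    isCWComplex_zero_discrete A, fun _ ↦ ⟨coprod.inl, coprod.inr, ⟨coprodIsCoprod _ _⟩⟩,
    ⟨coproductIsCoproduct _⟩, ⟨discreteCofanIsColimit I⟩, fun i ↦ ?_,
    isCofibrant _, _, _, freeIsoProj I, k, l, hX,
    cofibration_of_injective _ (sigmaMap_injective _ fun _ ↦ endpoints_injective),
    trivialFibrations_freeIsoProj I, rfl⟩
  refine (Limits.Sigma.ι_map_assoc _ _ _).trans ((whisker_eq _ (ι_freeIsoProj i)).trans ?_)
  exact coprod.hom_ext (hom_terminal_ext rfl) (hom_terminal_ext rfl)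

/-! ### Pushouts of groupoids -/

/-- A functor from a groupoid factors through the core of its target. -/
noncomputable def toCore {B P : Type*} [Category B] [IsGroupoid B] [Category P] (F : B ⥤ P) :
    B ⥤ Core P where
  obj x := ⟨F.obj x⟩
  map m := ⟨asIso (F.map m)⟩

theorem functor_core_ext {A P : Type*} [Category A] [Category P] {F G : A ⥤ Core P}
    (h : F ⋙ Core.inclusion P = G ⋙ Core.inclusion P) : F = G := by
  have ho (x : A) : F.obj x = G.obj x := congrArg Core.mk (Functor.congr_obj h x)
  refine CategoryTheory.Functor.ext ho fun x y m ↦ (Core.inclusion P).map_injective ?_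
  rw [Functor.map_comp, Functor.map_comp, eqToHom_map, eqToHom_map]
  exact Functor.congr_hom h m

/-- Both legs factor through `Core P`, so the inclusion `Core P ⥤ P` has a section. Every morphism
of `P` is then the underlying morphism of an isomorphism. -/
theorem isGroupoid_of_isPushout {A B C P : Cat.{u, u}} {f : A ⟶ B} {g : A ⟶ C} {k : B ⟶ P}
    {l : C ⟶ P} (hP : IsPushout f g k l) [IsGroupoid B] [IsGroupoid C] : IsGroupoid P := by
  have w : f ≫ (toCore k.toFunctor).toCatHom = g ≫ (toCore l.toFunctor).toCatHom :=
    Cat.Hom.ext <| functor_core_ext congr($(hP.w).toFunctor)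
  have h : hP.desc _ _ w ≫ (Core.inclusion P).toCatHom = 𝟙 P := by
    refine hP.hom_ext ?_ ?_
    · exact (hP.inl_desc_assoc _ _ w _).trans rfl
    · exact (hP.inr_desc_assoc _ _ w _).trans rfl
  refine ⟨fun {x y} m ↦ (NatIso.isIso_map_iff (eqToIso congr($(h).toFunctor)) m).1 ?_⟩
  exact ((hP.desc _ _ w).toFunctor.map m).iso.isIso_hom

/-! ### Freeness tested on functors to groups -/

/-- Functors from `P` to groups are freely determined by their values on the morphisms `e`. -/
def IsFreeOn {P : Type u} [Category.{u} P] {J : Type u} {s t : J → P} (e : ∀ j, s j ⟶ t j) : Prop :=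
  ∀ (G : Type u) [Group G] (a : J → G), ∃! F : P ⥤ SingleObj G, ∀ j, F.map (e j) = a j

theorem functor_singleObj_ext {P G : Type*} [Category P] [Monoid G] {F F' : P ⥤ SingleObj G}
    (h : ∀ (x y : P) (m : x ⟶ y), (F.map m : G) = F'.map m) : F = F' :=
  Functor.hext (fun _ ↦ rfl) fun x y m ↦ heq_of_eq (h x y m)

/-- The free groupoid structure given by a freely generating family. -/
noncomputable abbrev IsFreeOn.isFreeGroupoid {P : Type u} [Groupoid.{u} P] {J : Type u}
    {s t : J → P} {e : ∀ j, s j ⟶ t j} (h : IsFreeOn e) : IsFreeGroupoid P where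
  quiverGenerators := ⟨fun a b ↦ {j : J // s j = a ∧ t j = b}⟩
  of j := eqToHom j.2.1.symm ≫ e j.1 ≫ eqToHom j.2.2
  unique_lift {G} _ f := by
    obtain ⟨F, hF, hF'⟩ := h G fun j ↦ f ⟨j, rfl, rfl⟩
    refine ⟨F, ?_, fun F' hF'' ↦ hF' F' fun j ↦ ?_⟩
    · rintro _ _ ⟨j, rfl, rfl⟩
      simpa using hF j
    · simpa using hF'' _ _ ⟨j, rfl, rfl⟩

/-- The connected component of an object of a groupoid. -/
abbrev ComponentOf {P : Type u} [Category.{u} P] (x : P) : Type u :=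
  ObjectProperty.FullSubcategory fun y : P ↦ Nonempty (x ⟶ y)

section

variable {P : Type u} [Category.{u} P] [IsGroupoid P]

open Classical in
/-- Extend a functor from a component to a group by the trivial functor on the other
components. -/
noncomputable def extendFunctor {x : P} {G : Type u} [Group G] (F : ComponentOf x ⥤ SingleObj G) :
    P ⥤ SingleObj G where
  obj _ := SingleObj.star G
  map {a b} m := if h : Nonempty (x ⟶ a) then
    (F.map (X := ⟨a, h⟩) (Y := ⟨b, ⟨h.some ≫ m⟩⟩) (ObjectProperty.homMk m) : G) else (1 : G)
  map_id a := by
    split_ifs with h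
    · exact F.map_id (⟨a, h⟩ : ComponentOf x)
    · rfl
  map_comp {a b c} m n := by
    by_cases h : Nonempty (x ⟶ a)
    · have hb : Nonempty (x ⟶ b) := ⟨h.some ≫ m⟩
      rw [dif_pos h, dif_pos h, dif_pos hb]
      exact F.map_comp (X := ⟨a, h⟩) (Y := ⟨b, hb⟩) (Z := ⟨c, ⟨hb.some ≫ n⟩⟩)
        (ObjectProperty.homMk m) (ObjectProperty.homMk n)
    -- Inverses are needed here: without them a morphism could enter the component from outside.
    · have hb : ¬ Nonempty (x ⟶ b) := fun hb ↦ h ⟨hb.some ≫ inv m⟩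
      rw [dif_neg h, dif_neg h, dif_neg hb]
      exact (mul_one (1 : G)).symm

theorem extendFunctor_map {x : P} {G : Type u} [Group G] (F : ComponentOf x ⥤ SingleObj G)
    {a b : ComponentOf x} (m : a ⟶ b) : (extendFunctor F).map m.hom = F.map m :=
  dif_pos a.2

theorem extendFunctor_map_of_not_nonempty {x : P} {G : Type u} [Group G]
    (F : ComponentOf x ⥤ SingleObj G) {a b : P} (m : a ⟶ b) (h : ¬ Nonempty (x ⟶ a)) :
    (extendFunctor F).map m = (1 : G) :=
  dif_neg h

/-- Existence is by restriction from `P`, with value 1 on the generators outside the component. For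
uniqueness, functors on the component are extended trivially to `P` and compared there on all
generators. -/
theorem IsFreeOn.component {J : Type u} {s t : J → P} {e : ∀ j, s j ⟶ t j} (h : IsFreeOn e)
    (x : P) : IsFreeOn (P := ComponentOf x) (J := {j // Nonempty (x ⟶ s j)})
      (s := fun j ↦ ⟨s j.1, j.2⟩) (t := fun j ↦ ⟨t j.1, ⟨j.2.some ≫ e j.1⟩⟩)
      fun j ↦ ObjectProperty.homMk (e j.1) := by
  classical
  intro G _ a
  obtain ⟨F, hF, -⟩ := h G fun j ↦ if hj : Nonempty (x ⟶ s j) then a ⟨j, hj⟩ else 1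
  refine ⟨ObjectProperty.ι _ ⋙ F, fun j ↦ (hF j.1).trans (dif_pos j.2), fun F₁ hF₁ ↦ ?_⟩
  have h₂ : extendFunctor F₁ = extendFunctor (x := x) (ObjectProperty.ι _ ⋙ F) := by
    refine (h G fun j ↦ (extendFunctor F₁).map (e j)).unique (fun _ ↦ rfl) fun j ↦ ?_
    by_cases hj : Nonempty (x ⟶ s j)
    · refine (dif_pos hj).trans (Eq.trans ?_ (dif_pos hj).symm)
      exact ((hF j).trans (dif_pos hj)).trans (hF₁ ⟨j, hj⟩).symm
    · rw [extendFunctor_map_of_not_nonempty _ _ hj, extendFunctor_map_of_not_nonempty _ _ hj]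
  refine functor_singleObj_ext fun y z m ↦ ?_
  rw [← extendFunctor_map, ← extendFunctor_map, h₂]

theorem IsFreeOn.isFreeGroup_aut {J : Type u} {s t : J → P} {e : ∀ j, s j ⟶ t j}
    (h : IsFreeOn e) (x : P) : IsFreeGroup (Aut x) := by
  let : Groupoid (ComponentOf x) :=
    { inv m := ObjectProperty.homMk (inv m.hom) }
  let x' : ComponentOf x := ⟨x, ⟨𝟙 x⟩⟩
  have : IsFreeGroupoid (ComponentOf x) := (h.component x).isFreeGroupoid
  have : Nonempty (ComponentOf x) := ⟨x'⟩
  have hz (y : ComponentOf x) : Zigzag x' y :=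
    Zigzag.of_hom (ObjectProperty.homMk y.2.some)
  have : IsConnected (ComponentOf x) :=
    zigzag_isConnected fun y z ↦ (hz y).symm.trans (hz z)
  have := IsFreeGroupoid.endIsFreeOfConnectedFree x'
  refine IsFreeGroup.ofMulEquiv (G := End x')
    { toFun m := asIso m.hom
      invFun m := ObjectProperty.homMk m.hom
      left_inv m := rfl
      right_inv m := by ext; rfl
      map_mul' m n := by ext; rfl }

end

/-! ### From CW-complexes to free automorphism groups -/

/-- The generators form a star in each component, joining a representative `r y` to the other
objects. A functor to a group is a difference of a function on objects, normalised to 1 at the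
representatives. -/
theorem isFreeOn_of_thin {C : Type u} [Category.{u} C] [IsGroupoid C]
    [∀ x y : C, Subsingleton (x ⟶ y)] :
    ∃ (J : Type u) (s t : J → C) (e : ∀ j, s j ⟶ t j), IsFreeOn e := by
  classical
  let r (y : C) : C := (Quotient.mk (isIsomorphicSetoid C) y).out
  let p (y : C) : r y ≅ y := (Quotient.mk_out (s := isIsomorphicSetoid C) y).some
  have hr (y : C) : r (r y) = r y :=
    congrArg Quotient.out (Quotient.out_eq (Quotient.mk (isIsomorphicSetoid C) y))
  -- Representatives are left out: their generator would be an identity, with forced value 1.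
  refine ⟨{y : C // r y ≠ y}, fun y ↦ r y.1, fun y ↦ y.1, fun y ↦ (p y.1).hom, fun G _ a ↦ ?_⟩
  refine ⟨SingleObj.differenceFunctor fun y ↦ if h : r y ≠ y then a ⟨y, h⟩ else 1, fun y ↦ ?_,
    fun F hF ↦ functor_singleObj_ext fun x y m ↦ ?_⟩
  · simp [hr, y.2]
  · have key (y : C) : F.map (p y).hom = if h : r y ≠ y then a ⟨y, h⟩ else 1 := by
      split_ifs with h
      · exact hF ⟨y, h⟩
      · have hy : r y = y := not_not.1 h
        rw [Subsingleton.elim (p y).hom (eqToHom hy), eqToHom_map]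
        rfl
    have hxy : r x = r y :=
      congrArg Quotient.out (Quotient.sound (s := isIsomorphicSetoid C) ⟨asIso m⟩)
    have hm : eqToHom hxy.symm ≫ (p x).hom ≫ m = (p y).hom := Subsingleton.elim _ _
    have := congrArg F.map hm
    rw [F.map_comp, F.map_comp, eqToHom_map, key, key] at this
    refine eq_mul_inv_of_mul_eq (Eq.trans ?_ this)
    exact (mul_one _).symm

theorem IsFreeOn.map_of_existsUnique {C P : Type u} [Category.{u} C] [Category.{u} P]
    {J : Type u} {s t : J → C} {e : ∀ j, s j ⟶ t j} (h : IsFreeOn e) (l : C ⥤ P)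
    (hl : ∀ (G : Type u) [Group G] (F₀ : C ⥤ SingleObj G), ∃! F : P ⥤ SingleObj G, l ⋙ F = F₀) :
    IsFreeOn fun j ↦ l.map (e j) := by
  intro G _ a
  obtain ⟨F₀, hF₀, hF₀'⟩ := h G a
  obtain ⟨F, rfl, hF'⟩ := hl G F₀
  exact ⟨F, hF₀, fun F₁ hF₁ ↦ hF' _ (hF₀' (l ⋙ F₁) hF₁)⟩

attribute [local instance] uliftCategory in
theorem existsUnique_functor_of_isPushout {A B C P : Cat.{u, u}} {f : A ⟶ B} {g : A ⟶ C}
    {k : B ⟶ P} {l : C ⟶ P} (hP : IsPushout f g k l)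
    (hA : ∀ (D : Cat.{u, u}) [Subsingleton D] (F F' : A ⟶ D), F = F')
    (hB : ∀ (D : Cat.{u, u}) [Subsingleton D] (F F' : B ⟶ D), F = F')
    (G : Type u) [Group G] (F₀ : C ⥤ SingleObj G) :
    ∃! F : P ⥤ SingleObj G, l.toFunctor ⋙ F = F₀ := by
  -- The object type of `SingleObj G` is lifted from universe 0 so that the pushout can be tested
  -- against it.
  let D : Cat.{u, u} := Cat.of (ULift.{u} (SingleObj G))
  have : Subsingleton D := inferInstanceAs (Subsingleton (ULift.{u} Unit))
  let b : B ⟶ D := ((Functor.const B).obj ⟨SingleObj.star G⟩).toCatHom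
  let c : C ⟶ D := (F₀ ⋙ ULift.upFunctor).toCatHom
  refine ⟨(hP.desc b c (hA D _ _)).toFunctor ⋙ ULift.downFunctor, ?_, fun F hF ↦ ?_⟩
  · exact congr(($(hP.inr_desc b c (hA D _ _))).toFunctor ⋙ ULift.downFunctor)
  · have : (F ⋙ ULift.upFunctor).toCatHom = hP.desc b c (hA D _ _) :=
      hP.hom_ext (hB D _ _) <| (congrArg (fun F ↦ (F ⋙ ULift.upFunctor).toCatHom) hF).trans
        (hP.inr_desc b c (hA D _ _)).symm
    rw [← this]
    rfl

theorem hom_ext_of_coproduct {I : Type u} {S : I → Cat.{u, u}} {s : Cofan S} (hs : IsColimit s)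
    (hS : ∀ i (D : Cat.{u, u}) [Subsingleton D] (F F' : S i ⟶ D), F = F')
    (D : Cat.{u, u}) [Subsingleton D] (F F' : s.pt ⟶ D) : F = F' :=
  Cofan.IsColimit.hom_ext hs _ _ fun i ↦ hS i D _ _

theorem isGroupoidWithFreeAut_of_isCWComplex {X : Cat.{u, u}} (h : IsCWComplex 1 X) :
    IsGroupoidWithFreeAut X := by
  obtain ⟨Y, I, S, s, t, f, g, ⟨_, J, ι, ⟨hY⟩⟩, hS, ⟨hs⟩, ⟨ht⟩, -, -, Y', g', y, k, l, hP, -, hy,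
    -⟩ := h
  have : y.toFunctor.IsEquivalence := hy.2
  have : IsDiscrete t.pt := isDiscrete_of_isColimit ht
  have : IsDiscrete Y := isDiscrete_of_isColimit hY
  have := isGroupoid_of_isDiscrete t.pt
  have := isGroupoid_of_isDiscrete Y
  have : IsGroupoid Y' := ⟨fun m ↦ isIso_of_reflects_iso m y.toFunctor⟩
  have (a b : Y') : Subsingleton (a ⟶ b) :=
    ⟨fun _ _ ↦ y.toFunctor.map_injective (Subsingleton.elim _ _)⟩
  have hX := isGroupoid_of_isPushout hP
  obtain ⟨J', a, b, e, he⟩ := isFreeOn_of_thin (C := Y')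
  have hT (D : Cat.{u, u}) [Subsingleton D] (F F' : ⊤_ Cat.{u, u} ⟶ D) : F = F' :=
    hom_terminal_ext (Subsingleton.elim _ _)
  refine ⟨hX, (he.map_of_existsUnique l.toFunctor <| existsUnique_functor_of_isPushout hP ?_ ?_)
    |>.isFreeGroup_aut⟩
  · refine hom_ext_of_coproduct hs fun i D _ F F' ↦ ?_
    obtain ⟨a, b, ⟨hab⟩⟩ := hS i
    exact BinaryCofan.IsColimit.hom_ext hab (hT D _ _) (hT D _ _)
  · exact hom_ext_of_coproduct hY fun _ ↦ hT

/-! ### Invariance under weak equivalence -/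

theorem IsGroupoidWithFreeAut.of_functor {X Y : Cat.{u, u}} (F : X ⥤ Y) [F.Full] [F.Faithful]
    (h : IsGroupoidWithFreeAut Y) : IsGroupoidWithFreeAut X := by
  obtain ⟨hY, hY'⟩ := h
  refine ⟨⟨fun m ↦ isIso_of_reflects_iso m F⟩, fun x ↦ ?_⟩
  have := hY' (F.obj x)
  exact IsFreeGroup.ofMulEquiv
    ((Functor.FullyFaithful.ofFullyFaithful F).autMulEquivOfFullyFaithful x).symm

theorem isGroupoidWithFreeAut_iff_of_weaklyEquivalent {X Y : Cat.{u, u}}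
    (h : WeaklyEquivalent X Y) : IsGroupoidWithFreeAut X ↔ IsGroupoidWithFreeAut Y := by
  induction h with
  | rel A B h =>
    obtain ⟨F, ⟨hF⟩⟩ := h
    have : F.toFunctor.IsEquivalence := hF
    exact ⟨.of_functor F.toFunctor.inv, .of_functor F.toFunctor⟩
  | refl => rfl
  | symm _ _ _ ih => exact ih.symm
  | trans _ _ _ _ _ h₁ h₂ => exact h₁.trans h₂

/-! ### Categories freely generated by isomorphisms -/

/-- The functor from the free isomorphism given by an isomorphism. -/
def FreeIso.functorOfIso {Z : Type*} [Category Z] {a b : Z} (e : a ≅ b) : FreeIso.{u} ⥤ Z where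
  obj
    | .left => a
    | .right => b
  map {x y} _ := match x, y with
    | .left, .left => 𝟙 a
    | .left, .right => e.hom
    | .right, .left => e.inv
    | .right, .right => 𝟙 b
  map_id x := by cases x <;> rfl
  map_comp {x y z} _ _ := by cases x <;> cases y <;> cases z <;> simp

/-- The free isomorphism between the two objects of `FreeIso`. -/
def FreeIso.iso : FreeIso.left.{u} ≅ FreeIso.right.{u} where
  hom := PUnit.unit
  inv := PUnit.unit

section Agree

variable {C Z : Type*} [Category C] [Category Z] {F G : C ⥤ Z} (ho : ∀ x, F.obj x = G.obj x)

/-- Two functors with the same values on objects agree on a morphism. -/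
def Agree {x y : C} (m : x ⟶ y) : Prop :=
  F.map m = eqToHom (ho x) ≫ G.map m ≫ eqToHom (ho y).symm

variable {ho}

theorem Agree.comp {x y z : C} {m : x ⟶ y} {n : y ⟶ z} (hm : Agree ho m) (hn : Agree ho n) :
    Agree ho (m ≫ n) := by
  unfold Agree at *
  simp [hm, hn]

theorem agree_eqToHom {x y : C} (h : x = y) : Agree ho (eqToHom h) := by
  subst h
  simp [Agree]

theorem Agree.inv {x y : C} {e : x ≅ y} (he : Agree ho e.hom) : Agree ho e.inv := by
  unfold Agree at *
  rw [← cancel_epi (F.map e.hom), ← F.map_comp, e.hom_inv_id, he]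
  simp [← G.map_comp_assoc]

end Agree

theorem FreeIso.functor_ext {Z : Type*} [Category Z] {F G : FreeIso.{u} ⥤ Z}
    (ho : ∀ x, F.obj x = G.obj x) (h : Agree ho FreeIso.iso.hom) : F = G := by
  refine CategoryTheory.Functor.ext ho fun x y m ↦ ?_
  cases x <;> cases y
  · exact agree_eqToHom (ho := ho) rfl
  · exact h
  · exact h.inv
  · exact agree_eqToHom (ho := ho) rfl

/-- A category with the universal property of a category freely generated by the isomorphisms `e`
arises from a discrete category by attaching free isomorphisms. -/
theorem arisesByAttachingFreeIsos_of_universal {X : Cat.{u, u}} {I : Type u} {s t : I → X}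
    (e : ∀ i, s i ≅ t i)
    (hex : ∀ (Z : Cat.{u, u}) (o : X → Z) (a : ∀ i, o (s i) ≅ o (t i)),
      ∃ (F : X ⥤ Z) (ho : ∀ x, F.obj x = o x),
        ∀ i, F.map (e i).hom = eqToHom (ho _) ≫ (a i).hom ≫ eqToHom (ho _).symm)
    (huniq : ∀ (Z : Cat.{u, u}) (F G : X ⥤ Z) (ho : ∀ x, F.obj x = G.obj x),
      (∀ i, Agree ho (e i).hom) → F = G) :
    ArisesByAttachingFreeIsos X := by
  let S (_ : I) : Cat.{u, u} := (⊤_ Cat.{u, u}) ⨿ (⊤_ Cat.{u, u})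
  let D (_ : I) : Cat.{u, u} := Cat.of FreeIso.{u}
  let d (i : I) : S i ⟶ Cat.of (Discrete X) := coprod.desc
    ((Functor.const (⊤_ Cat.{u, u})).obj (Discrete.mk (s i))).toCatHom
    ((Functor.const (⊤_ Cat.{u, u})).obj (Discrete.mk (t i))).toCatHom
  let f : ∐ S ⟶ Cat.of (Discrete X) := Limits.Sigma.desc d
  let k : Cat.of (Discrete X) ⟶ X := (Discrete.functor fun x : X ↦ x).toCatHom
  let E (i : I) : D i ⟶ X := (FreeIso.functorOfIso (e i)).toCatHom
  let l : ∐ D ⟶ X := Limits.Sigma.desc E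
  let p (i : I) : S i ⟶ D i := FreeIso.endpoints
  let g : ∐ S ⟶ ∐ D :=
    Limits.Sigma.map p
  have hl (i : I) : Limits.Sigma.ι D i ≫ l = E i := Limits.Sigma.ι_desc _ _
  have hf (i : I) : Limits.Sigma.ι S i ≫ f = d i := Limits.Sigma.ι_desc _ _
  have hf₁ (i : I) : coprod.inl ≫ Limits.Sigma.ι S i ≫ f =
      ((Functor.const (⊤_ Cat.{u, u})).obj (Discrete.mk (s i))).toCatHom :=
    (whisker_eq _ (hf i)).trans (coprod.inl_desc _ _)
  have hf₂ (i : I) : coprod.inr ≫ Limits.Sigma.ι S i ≫ f =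
      ((Functor.const (⊤_ Cat.{u, u})).obj (Discrete.mk (t i))).toCatHom :=
    (whisker_eq _ (hf i)).trans (coprod.inr_desc _ _)
  have hg (i : I) : Limits.Sigma.ι S i ≫ g = p i ≫ Limits.Sigma.ι D i := Limits.Sigma.ι_map p i
  have hg₁ (i : I) : coprod.inl ≫ Limits.Sigma.ι S i ≫ g =
      FreeIso.point .left ≫ Limits.Sigma.ι D i :=
    (whisker_eq _ (hg i)).trans (coprod.inl_desc_assoc _ _ _)
  have hg₂ (i : I) : coprod.inr ≫ Limits.Sigma.ι S i ≫ g =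
      FreeIso.point .right ≫ Limits.Sigma.ι D i :=
    (whisker_eq _ (hg i)).trans (coprod.inr_desc_assoc _ _ _)
  have w : f ≫ k = g ≫ l := by
    refine Limits.Sigma.hom_ext _ _ fun i ↦ coprod.hom_ext ?_ ?_
    · refine (eq_whisker (hf₁ i) k).trans ((hom_terminal_ext rfl).trans
        ((eq_whisker (hg₁ i) l).trans ((Category.assoc _ _ _).trans (whisker_eq _ (hl i)))).symm)
    · refine (eq_whisker (hf₂ i) k).trans ((hom_terminal_ext rfl).trans
        ((eq_whisker (hg₂ i) l).trans ((Category.assoc _ _ _).trans (whisker_eq _ (hl i)))).symm)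
  have hdesc (Z : Cat.{u, u}) (k' : Cat.of (Discrete X) ⟶ Z)
      (l' : ∐ D ⟶ Z) (w' : f ≫ k' = g ≫ l') :
      ∃ d : X ⟶ Z, k ≫ d = k' ∧ l ≫ d = l' := by
    -- `H i` records the isomorphism of `Z` chosen by `l'` on the `i`-th cell. Its ends match `k'`
    -- only up to equality of objects, hence the `eqToIso` corrections below.
    let H (i : I) : FreeIso.{u} ⥤ Z := (Limits.Sigma.ι D i ≫ l').toFunctor
    have hs (i : I) : k'.toFunctor.obj ⟨s i⟩ = (H i).obj .left :=
      congr(($((eq_whisker (hf₁ i) k').symm.trans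
        ((whisker_eq _ (whisker_eq _ w')).trans (eq_whisker (hg₁ i) l')))).toFunctor.obj
          terminalObj)
    have ht (i : I) : k'.toFunctor.obj ⟨t i⟩ = (H i).obj .right :=
      congr(($((eq_whisker (hf₂ i) k').symm.trans
        ((whisker_eq _ (whisker_eq _ w')).trans (eq_whisker (hg₂ i) l')))).toFunctor.obj
          terminalObj)
    obtain ⟨F, ho, hF⟩ := hex Z (fun x ↦ k'.toFunctor.obj ⟨x⟩)
      fun i ↦ eqToIso (hs i) ≪≫ (H i).mapIso FreeIso.iso ≪≫ eqToIso (ht i).symm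
    refine ⟨F.toCatHom, Cat.Hom.ext <| functor_ext_of_isDiscrete (C := Discrete X)
      fun x ↦ ho x.as, Limits.Sigma.hom_ext _ _ fun i ↦ (eq_whisker (hl i) F.toCatHom).trans
        (Cat.Hom.ext <| FreeIso.functor_ext (F := FreeIso.functorOfIso (e i) ⋙ F) (G := H i) ?_ ?_)⟩
    · rintro (_ | _)
      · exact (ho _).trans (hs i)
      · exact (ho _).trans (ht i)
    · refine (hF i).trans ?_
      simp
      rfl
  have hhom (Z : Cat.{u, u}) (d d' : X ⟶ Z) (hk : k ≫ d = k ≫ d') (hl' : l ≫ d = l ≫ d') :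
      d = d' := by
    refine Cat.Hom.ext <| huniq Z d.toFunctor d'.toFunctor
      (fun x ↦ congr($(hk).toFunctor.obj ⟨x⟩)) fun i ↦ ?_
    have h : E i ≫ d = E i ≫ d' := (eq_whisker (hl i) d).symm.trans
      ((whisker_eq _ hl').trans (eq_whisker (hl i) d'))
    exact Functor.congr_hom congr($(h).toFunctor) FreeIso.iso.hom
  choose d hd₁ hd₂ using hdesc
  exact ⟨X, I, f, k, l, ⟨w⟩, ⟨PushoutCocone.IsColimit.mk w (fun c ↦ d _ _ _ c.condition)
    (fun c ↦ hd₁ _ _ _ c.condition) (fun c ↦ hd₂ _ _ _ c.condition)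
    fun c m h₁ h₂ ↦ hhom _ _ _ (h₁.trans (hd₁ _ _ _ c.condition).symm)
      (h₂.trans (hd₂ _ _ _ c.condition).symm)⟩⟩

/-! ### Free generators of a groupoid with free automorphism groups -/

theorem arisesByAttachingFreeIsos_of_isGroupoidWithFreeAut {X : Cat.{u, u}}
    (h : IsGroupoidWithFreeAut X) : ArisesByAttachingFreeIsos X := by
  classical
  obtain ⟨_, hfree⟩ := h
  let K := Quotient (isIsomorphicSetoid X)
  let M (x : X) : K := Quotient.mk _ x
  have hM {x y : X} (m : x ⟶ y) : M x = M y := Quotient.sound (s := isIsomorphicSetoid X) ⟨asIso m⟩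
  have hbase (c : K) : M c.out = c := Quotient.out_eq c
  have hP (c : K) (x : X) (hx : M x = c) : Nonempty (c.out ≅ x) :=
    Quotient.exact (s := isIsomorphicSetoid X) ((hbase c).trans hx.symm)
  -- The case split makes the path to the base object an identity. The label `c` is kept apart from
  -- `M x`, so that objects of one component share a base without transport.
  let P (c : K) (x : X) (hx : M x = c) : c.out ≅ x :=
    if h : c.out = x then eqToIso h else (hP c x hx).some
  let I : Type u := {q : K × X // M q.2 = q.1 ∧ q.1.out ≠ q.2} ⊕
    Σ c : K, IsFreeGroup.Generators (Aut c.out)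
  let s : I → X := Sum.elim (fun q ↦ q.1.1.out) fun q ↦ q.1.out
  let t : I → X := Sum.elim (fun q ↦ q.1.2) fun q ↦ q.1.out
  let e : ∀ i : I, s i ≅ t i
    | .inl q => P q.1.1 q.1.2 q.2.1
    | .inr q => (IsFreeGroup.of q.2 : Aut q.1.out)
  have hPbase (c : K) : P c c.out (hbase c) = Iso.refl _ := dif_pos rfl
  refine arisesByAttachingFreeIsos_of_universal e (fun Z o a ↦ ?_) fun Z F G ho he ↦ ?_
  · let φ (c : K) : Aut c.out →* Aut (o c.out) := IsFreeGroup.lift fun g ↦ a (.inr ⟨c, g⟩)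
    let q (c : K) (x : X) (hx : M x = c) : o c.out ≅ o x :=
      if h : c.out = x then eqToIso (congrArg o h) else a (.inl ⟨(c, x), hx, h⟩)
    have hqbase (c : K) : q c c.out (hbase c) = Iso.refl _ := dif_pos rfl
    let L (c : K) (x y : X) (hx : M x = c) (hy : M y = c) (m : x ⟶ y) : Aut c.out :=
      P c x hx ≪≫ asIso m ≪≫ (P c y hy).symm
    -- A morphism is closed up to a loop at the base by the paths `P`, sent through `φ`, and opened
    -- again by the prescribed paths `q`.
    let T (c : K) (x y : X) (hx : M x = c) (hy : M y = c) (m : x ⟶ y) : o x ⟶ o y :=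
      (q c x hx).inv ≫ (φ c (L c x y hx hy m)).hom ≫ (q c y hy).hom
    have hTid (c : K) (x : X) (hx : M x = c) : T c x x hx hx (𝟙 x) = 𝟙 _ := by
      have : L c x x hx hx (𝟙 x) = 1 := by
        ext
        exact (whisker_eq _ (Category.id_comp _)).trans (P c x hx).hom_inv_id
      simp only [T]
      rw [this, map_one]
      exact (whisker_eq _ (Category.id_comp _)).trans (q c x hx).inv_hom_id
    have hTcomp (c : K) (x y z : X) (hx : M x = c) (hy : M y = c) (hz : M z = c) (m : x ⟶ y)
        (n : y ⟶ z) : T c x z hx hz (m ≫ n) = T c x y hx hy m ≫ T c y z hy hz n := by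
      -- Multiplication in `Aut` is composition in the opposite order.
      have : L c x z hx hz (m ≫ n) = L c y z hy hz n * L c x y hx hy m := by
        ext
        refine Eq.trans ?_ (Iso.trans_hom (L c x y hx hy m) (L c y z hy hz n)).symm
        simp [L]
      simp only [T]
      rw [this, map_mul]
      simp [Aut.Aut_mul_def, Iso.trans_hom (φ c (L c x y hx hy m)) (φ c (L c y z hy hz n))]
    let F : X ⥤ Z :=
      { obj := o
        map {x y} m := T (M x) x y rfl (hM m).symm m
        map_id x := hTid (M x) x rfl
        map_comp {x y z} m n := by
          have key (c : K) (hc : M y = c) (hz : M z = c) :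
              T (M y) y z rfl (hM n).symm n = T c y z hc hz n := by
            subst hc
            rfl
          have hz := ((hM m).trans (hM n)).symm
          exact (hTcomp (M x) x y z rfl (hM m).symm hz m n).trans
            (whisker_eq _ (key (M x) (hM m).symm hz).symm) }
    have hF (c : K) (x y : X) (hx : M x = c) (hy : M y = c) (m : x ⟶ y) :
        F.map m = T c x y hx hy m := by
      subst hx
      rfl
    refine ⟨F, fun _ ↦ rfl, ?_⟩
    rintro (⟨⟨c, x⟩, hx, hne⟩ | ⟨c, g⟩)
    · refine (hF c c.out x (hbase c) hx _).trans ?_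
      have hL : L c c.out x (hbase c) hx (P c x hx).hom = 1 := by
        ext
        simp only [L, hPbase]
        exact (Category.id_comp _).trans (P c x hx).hom_inv_id
      have hq : q c x hx = a (.inl ⟨(c, x), hx, hne⟩) := dif_neg hne
      simp only [T, e, hL, map_one, hqbase, hq]
      simp only [eqToHom_refl, Category.id_comp, Category.comp_id]
      simp
      exact Category.id_comp _
    · refine (hF c c.out c.out (hbase c) (hbase c) _).trans ?_
      have hL : L c c.out c.out (hbase c) (hbase c) (e (.inr ⟨c, g⟩)).hom = IsFreeGroup.of g := by
        ext
        simp only [L, hPbase]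
        simp
        rfl
      have hφ : φ c (IsFreeGroup.of g) = a (.inr ⟨c, g⟩) := IsFreeGroup.lift_of _ _
      simp only [T, hL, hqbase, hφ]
      simp
  -- Uniqueness: up to conjugation by the object equalities, `F` and `G` induce homomorphisms on the
  -- free group `Aut c.out` that agree on generators. Any morphism is an inverse path, a loop and a
  -- path.
  · have hloop (c : K) (m : Aut c.out) : Agree ho m.hom := by
      have : F.mapAut c.out =
          (Aut.autMulEquivOfIso (eqToIso (ho c.out).symm)).toMonoidHom.comp (G.mapAut c.out) := by
        refine IsFreeGroup.ext_hom fun g ↦ ?_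
        ext
        refine (he (.inr ⟨c, g⟩)).trans ?_
        simp [Aut.autMulEquivOfIso]
        rfl
      refine congr(($this m).hom).trans ?_
      simp [Aut.autMulEquivOfIso]
      rfl
    have hPagree (c : K) (x : X) (hx : M x = c) : Agree ho (P c x hx).hom := by
      by_cases h : c.out = x
      · have : P c x hx = eqToIso h := dif_pos h
        rw [this]
        exact agree_eqToHom h
      · exact he (.inl ⟨(c, x), hx, h⟩)
    refine CategoryTheory.Functor.ext ho fun x y m ↦ ?_
    let n : Aut (M x).out := P _ x rfl ≪≫ asIso m ≪≫ (P _ y (hM m).symm).symm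
    have hm : (P _ x rfl).inv ≫ n.hom ≫ (P _ y (hM m).symm).hom = m := by simp [n]
    have := (hPagree _ x rfl).inv.comp ((hloop _ n).comp (hPagree _ y (hM m).symm))
    rw [hm] at this
    exact this

end FormalCW

theorem mainTheorem6 (X : CategoryTheory.Cat.{u, u}) :
    (FormalCW.IsCWComplex 1 X ↔ FormalCW.IsGroupoidWithFreeAut X) ∧
    (FormalCW.IsCWComplex 1 X ↔ FormalCW.ArisesByAttachingFreeIsos X) ∧
    ((∃ Y : CategoryTheory.Cat.{u, u},
        FormalCW.IsCWComplex 1 Y ∧ FormalCW.WeaklyEquivalent X Y) ↔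
      FormalCW.IsGroupoidWithFreeAut X) := by
  have h₁ := @FormalCW.isGroupoidWithFreeAut_of_isCWComplex.{u}
  have h₂ := @FormalCW.arisesByAttachingFreeIsos_of_isGroupoidWithFreeAut.{u}
  have h₃ := @FormalCW.isCWComplex_one_of_arisesByAttachingFreeIsos.{u}
  refine ⟨⟨h₁, fun h ↦ h₃ (h₂ h)⟩, ⟨fun h ↦ h₂ (h₁ h), h₃⟩, ?_, fun h ↦ ?_⟩
  · rintro ⟨Y, hY, hXY⟩
    exact (FormalCW.isGroupoidWithFreeAut_iff_of_weaklyEquivalent hXY).2 (h₁ hY)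
  · exact ⟨X, h₃ (h₂ h), Relation.EqvGen.refl X⟩
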